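/- Let $N,M$ be positive integers, $k\ge 0$ an integer, $A\subset\mathbb R^k$ compact, and let $f:\mathbb R^N\times\mathbb R^M\times A\to\mathbb R^N$, $g:\mathbb R^N\times\mathbb R^M\times A\to\mathbb R^M$, $\ell:\mathbb R^N\times\mathbb R^M\times A\to\mathbb R$, $u_0:\mathbb R^N\times\mathbb R^M\to\mathbb R$ satisfy: - there is $L_0>0$ with $|f(x_1,y_1,a)-f(x_2,y_2,a)|\le L_0(|x_1-x_2|+|y_1-y_2|)$ and $|g(x_1,y_1,a)-g(x_2,y_2,a)|\le L_0(|x_1-x_2|+|y_1-y_2|)$ for all $x_1,x_2\in\mathbb R^N$, $y_1,y_2\in\mathbb R^M$, $a\in A$; moreover $|f|$ is bounded; - for every compact $K\subset\mathbb R^N\times\mathbb R^M$ there is $r>0$ such that $B(0,r)\subset\overline{\mathrm{co}}\,g(x,y,A)$ for all $(x,y)\in K$; - $\ell$ is continuous, and for every compact $B\subset\mathbb R^N$, $\ell(x,y,a)\to+\infty$ as $|y|\to+\infty$, uniformly in $(x,a)\in B\times A$; - $u_0$ is continuous and bounded from below. For $\varepsilon>0$, $(x,y)\in\mathbb R^N\times\mathbb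 R^M$ and $t\ge 0$ let $$V^\varepsilon(x,y,t)=\inf\Big\{\varepsilon\int_0^{t/\varepsilon}\ell(\xi(s),\eta(s),\alpha(s))\,ds+u_0\big(\xi(t/\varepsilon),\eta(t/\varepsilon)\big)\Big\},$$ where the infimum is over all measurable controls $\alpha:[0,+\infty)\to A$ and all locally absolutely continuous $(\xi,\eta):[0,+\infty)\to\mathbb R^N\times\mathbb R^M$ with $\dot\xi=\varepsilon f(\xi,\eta,\alpha)$, $\dot\eta=g(\xi,\eta,\alpha)$ a.e., where $f(\xi,\eta,\alpha)$ and $g(\xi,\eta,\alpha)$ are locally integrable, and $(\xi,\eta)(0)=(x,y)$. Define the weak semilimits $$({\liminf}_\#V^\varepsilon)(x,y,t)=\inf\Big\{\liminf_{n}V^{\varepsilon_n}(x_n,y_n,t_n)\Big\},\qquad ({\limsup}^\#V^\varepsilon)(x,y,t)=\sup\Big\{\limsup_{n}V^{\varepsilon_n}(x_n,y_n,t_n)\Big\},$$ the infimum and supremum being over all sequences $\varepsilon_n\to0$ with $\varepsilon_n>0$ and $(x_n,y_n,t_n)\to(x,y,t)$ with $t_n\ge0$. Then for all $x_0\in\mathbb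 R^N$, $y_0,z_0\in\mathbb R^M$ and $t_0>0$, $$({\liminf}_\#V^\varepsilon)(x_0,y_0,t_0)=({\liminf}_\#V^\varepsilon)(x_0,z_0,t_0),\qquad ({\limsup}^\#V^\varepsilon)(x_0,y_0,t_0)=({\limsup}^\#V^\varepsilon)(x_0,z_0,t_0).$$ Moreover these common values are finite, so that they define real-valued functions $\underline V(x_0,t_0)$ and $\overline V(x_0,t_0)$ on $\mathbb R^N\times(0,+\infty)$. -/

import Mathlib

open Filter Topology MeasureTheory
open scoped NNReal

namespace SingPert

/-- Euclidean space `ℝⁿ`. -/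
abbrev E (n : ℕ) : Type := EuclideanSpace ℝ (Fin n)

/-- `(ξ, η)` is a (Carathéodory) solution on `[0, +∞)` of the controlled dynamics
`ξ' = ε f(ξ, η, α)`, `η' = g(ξ, η, α)` with initial datum `(x, y)`, written in integral form,
which is the same as local absolute continuity plus the equations for almost every time. -/
structure IsTrajectory {N M : ℕ} {A : Type*}
    (f : E N → E M → A → E N) (g : E N → E M → A → E M)
    (ε : ℝ) (α : ℝ → A) (x : E N) (y : E M) (ξ : ℝ → E N) (η : ℝ → E M) : Prop where
  continuousOn_slow : ContinuousOn ξ (Set.Ici 0)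
  continuousOn_fast : ContinuousOn η (Set.Ici 0)
  integrable_slow : ∀ t, 0 ≤ t →
    IntervalIntegrable (fun s => f (ξ s) (η s) (α s)) volume 0 t
  integrable_fast : ∀ t, 0 ≤ t →
    IntervalIntegrable (fun s => g (ξ s) (η s) (α s)) volume 0 t
  slow_eq : ∀ t, 0 ≤ t → ξ t = x + ∫ s in (0 : ℝ)..t, ε • f (ξ s) (η s) (α s)
  fast_eq : ∀ t, 0 ≤ t → η t = y + ∫ s in (0 : ℝ)..t, g (ξ s) (η s) (α s)

/-- The cost `ε ∫₀^{t/ε} ℓ(ξ, η, α) ds + u₀(ξ(t/ε), η(t/ε))`. -/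
noncomputable def cost {N M : ℕ} {A : Type*}
    (l : E N → E M → A → ℝ) (u₀ : E N → E M → ℝ)
    (ε : ℝ) (t : ℝ≥0) (α : ℝ → A) (ξ : ℝ → E N) (η : ℝ → E M) : ℝ :=
  ε * (∫ s in (0 : ℝ)..(t / ε), l (ξ s) (η s) (α s)) + u₀ (ξ (t / ε)) (η (t / ε))

/-- The value function `V^ε` at `(x, y, t)`: the infimum of the cost over all measurable controls
`α` with values in `A` (only their restriction to `[0, +∞)` matters) and the corresponding
trajectories issued from `(x, y)`. The infimum is taken in the extended reals. -/
noncomputable def valueFunction {N M : ℕ} {A : Type*} [MeasurableSpace A]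
    (f : E N → E M → A → E N) (g : E N → E M → A → E M)
    (l : E N → E M → A → ℝ) (u₀ : E N → E M → ℝ)
    (ε : ℝ) (p : E N × E M × ℝ≥0) : EReal :=
  sInf {c : EReal | ∃ (α : ℝ → A) (ξ : ℝ → E N) (η : ℝ → E M),
    Measurable α ∧ IsTrajectory f g ε α p.1 p.2.1 ξ η ∧
      c = ((cost l u₀ ε p.2.2 α ξ η : ℝ) : EReal)}

/-- The lower weak semilimit at `p`, as `ε → 0⁺`, of a family `u ε` of functions:
the infimum of `liminf_n u^{ε_n}(p_n)` over all `ε_n → 0`, `ε_n > 0`, and `p_n → p`. -/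
noncomputable def lowerSemilimit {X : Type*} [TopologicalSpace X]
    (u : ℝ → X → EReal) (p : X) : EReal :=
  sInf {c : EReal | ∃ (ε : ℕ → ℝ) (q : ℕ → X), (∀ n, 0 < ε n) ∧
    Tendsto ε atTop (𝓝 0) ∧ Tendsto q atTop (𝓝 p) ∧
      c = liminf (fun n => u (ε n) (q n)) atTop}

/-- The upper weak semilimit at `p`, as `ε → 0⁺`, of a family `u ε` of functions:
the supremum of `limsup_n u^{ε_n}(p_n)` over all `ε_n → 0`, `ε_n > 0`, and `p_n → p`. -/
noncomputable def upperSemilimit {X : Type*} [TopologicalSpace X]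
    (u : ℝ → X → EReal) (p : X) : EReal :=
  sSup {c : EReal | ∃ (ε : ℕ → ℝ) (q : ℕ → X), (∀ n, 0 < ε n) ∧
    Tendsto ε atTop (𝓝 0) ∧ Tendsto q atTop (𝓝 p) ∧
      c = limsup (fun n => u (ε n) (q n)) atTop}

/-- The vector fields are Lipschitz in the state variables uniformly with respect to the control,
and the slow one is bounded. -/
def DynamicsAssumption {N M : ℕ} {A : Type*}
    (f : E N → E M → A → E N) (g : E N → E M → A → E M) : Prop :=
  (∃ L₀ : ℝ, 0 < L₀ ∧ ∀ (x₁ x₂ : E N) (y₁ y₂ : E M) (a : A),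
    ‖f x₁ y₁ a - f x₂ y₂ a‖ ≤ L₀ * (‖x₁ - x₂‖ + ‖y₁ - y₂‖) ∧
    ‖g x₁ y₁ a - g x₂ y₂ a‖ ≤ L₀ * (‖x₁ - x₂‖ + ‖y₁ - y₂‖)) ∧
  ∃ Q₀ : ℝ, ∀ (x : E N) (y : E M) (a : A), ‖f x y a‖ ≤ Q₀

/-- Total controllability of the fast dynamics: locally uniformly in `(x, y)`, the closed convex
hull of `g(x, y, A)` contains a ball centered at the origin. -/
def TotalControllability {N M : ℕ} {A : Type*} (g : E N → E M → A → E M) : Prop :=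
  ∀ K : Set (E N × E M), IsCompact K → ∃ r : ℝ, 0 < r ∧ ∀ p ∈ K,
    Metric.ball (0 : E M) r ⊆ closure (convexHull ℝ (Set.range (g p.1 p.2)))

/-- The running cost is continuous and coercive in the fast variable, uniformly for the slow
variable in a compact set and for the control in `A`. -/
def RunningCostAssumption {N M : ℕ} {A : Type*} [TopologicalSpace A]
    (l : E N → E M → A → ℝ) : Prop :=
  Continuous (fun p : E N × E M × A => l p.1 p.2.1 p.2.2) ∧
  ∀ B : Set (E N), IsCompact B → ∀ c : ℝ, ∃ R : ℝ, ∀ y : E M, R ≤ ‖y‖ →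
    ∀ x ∈ B, ∀ a : A, c ≤ l x y a

/-- The terminal cost is continuous and bounded from below. -/
def TerminalCostAssumption {N M : ℕ} (u₀ : E N → E M → ℝ) : Prop :=
  Continuous (fun p : E N × E M => u₀ p.1 p.2) ∧ ∃ c : ℝ, ∀ x y, c ≤ u₀ x y

end SingPert

/-! Over a fast time `T` bounded independently of `ε`, the slow variable moves by `O(εT)` and the
running cost contributes `O(εT)`. Total controllability allows the fast variable to be steered from
near `y₀` to near `z₀` in such a time. The dynamic programming inequality `valueFunction_le_add`
then bounds `V^ε` near `(x₀, y₀, t₀)` by `V^ε` at some point near `(x₀, z₀, t₀)` plus a vanishing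
error. The reverse bound comes from steering with the fields `-f`, `-g` and running the path
backwards. Exchanging `y₀` and `z₀` gives equality of both semilimits.

The steering (`exists_regulated`) is a sampled feedback: at times `nδ`, pick a control whose
velocity points towards the target at a uniform rate, and hold it for a time `δ`. Such controls
exist by separation from the convex hull and compactness (`TotalControllability.uniformDescent`).
The resulting control is piecewise constant, hence measurable, so neither relaxation nor a
measurable selection is needed.

Finiteness: on `[0, t/ε]` the slow variable moves by at most `Qt`. Coercivity bounds the cost below,
and holding the fast variable near `y₀` bounds it above. -/

namespace SingPert

/-! ### Primitives, gluing in time, and sampled feedback -/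

open Set

/-- `q` is, on `[0, τ]`, the primitive of the integrable function `h` with value `x` at `0`. -/
structure IsPrimitiveOn {X : Type*} [NormedAddCommGroup X] [NormedSpace ℝ X]
    (τ : ℝ) (x : X) (q h : ℝ → X) : Prop where
  integrable : IntervalIntegrable h volume 0 τ
  eq_add : ∀ t ∈ Icc 0 τ, q t = x + ∫ s in (0 : ℝ)..t, h s

section Primitive

variable {X Y : Type*} [NormedAddCommGroup X] [NormedSpace ℝ X]
  [NormedAddCommGroup Y] [NormedSpace ℝ Y]

namespace IsPrimitiveOn

variable {τ σ : ℝ} {x : X} {q h q' h' : ℝ → X}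

lemma apply_zero (H : IsPrimitiveOn τ x q h) (hτ : 0 ≤ τ) : q 0 = x := by
  simpa using H.eq_add 0 ⟨le_rfl, hτ⟩

lemma mono (H : IsPrimitiveOn τ x q h) (hσ : 0 ≤ σ) (hστ : σ ≤ τ) : IsPrimitiveOn σ x q h where
  integrable := H.integrable.mono_set (by
    rw [uIcc_of_le hσ, uIcc_of_le (hσ.trans hστ)]; exact Icc_subset_Icc_right hστ)
  eq_add t ht := H.eq_add t ⟨ht.1, ht.2.trans hστ⟩

lemma continuousOn (H : IsPrimitiveOn τ x q h) (hτ : 0 ≤ τ) : ContinuousOn q (Icc 0 τ) := by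
  have h1 : ContinuousOn (fun t => x + ∫ s in (0 : ℝ)..t, h s) (Icc 0 τ) := by
    refine continuousOn_const.add ?_
    have := intervalIntegral.continuousOn_primitive_interval' H.integrable
      (a := 0) (left_mem_uIcc)
    rwa [uIcc_of_le hτ] at this
  exact h1.congr H.eq_add

lemma congr (H : IsPrimitiveOn τ x q h) (hτ : 0 ≤ τ) (hq : EqOn q' q (Icc 0 τ))
    (hh : EqOn h' h (Ico 0 τ)) : IsPrimitiveOn τ x q' h' where
  integrable := by
    refine H.integrable.congr_ae ?_
    rw [uIoc_of_le hτ, ← restrict_Ioo_eq_restrict_Ioc]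
    filter_upwards [ae_restrict_mem measurableSet_Ioo] with s hs
    exact (hh ⟨hs.1.le, hs.2⟩).symm
  eq_add t ht := by
    rw [hq ht, H.eq_add t ht]
    congr 1
    rw [intervalIntegral.integral_of_le ht.1, intervalIntegral.integral_of_le ht.1,
      integral_Ioc_eq_integral_Ioo, integral_Ioc_eq_integral_Ioo]
    refine setIntegral_congr_fun measurableSet_Ioo fun s hs => ?_
    exact (hh ⟨hs.1.le, hs.2.trans_le ht.2⟩).symm

lemma concat (H : IsPrimitiveOn τ x q h) (hτ : 0 ≤ τ) (hσ : 0 ≤ σ)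
    (H' : IsPrimitiveOn σ (q τ) (fun s => q (τ + s)) (fun s => h (τ + s))) :
    IsPrimitiveOn (τ + σ) x q h := by
  have hi : IntervalIntegrable h volume τ (τ + σ) := by
    have := H'.integrable.comp_sub_right τ
    simpa [add_comm] using this
  refine ⟨H.integrable.trans hi, fun t ht => ?_⟩
  rcases le_total t τ with h1 | h1
  · exact H.eq_add t ⟨ht.1, h1⟩
  · have h2 := H'.eq_add (t - τ) ⟨by linarith, by linarith [ht.2]⟩
    simp only [add_sub_cancel] at h2
    rw [h2, H.eq_add τ ⟨hτ, le_rfl⟩, add_assoc]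
    congr 1
    rw [intervalIntegral.integral_comp_add_left (fun s => h s) τ]
    simp only [add_zero, add_sub_cancel]
    refine intervalIntegral.integral_add_adjacent_intervals H.integrable (hi.mono_set ?_)
    rw [uIcc_of_le h1, uIcc_of_le (by linarith)]
    exact Icc_subset_Icc_right ht.2

lemma reverse (H : IsPrimitiveOn τ x q h) (hτ : 0 ≤ τ) :
    IsPrimitiveOn τ (q τ) (fun s => q (τ - s)) (fun s => -h (τ - s)) := by
  refine ⟨?_, fun t ht => ?_⟩
  · have := (H.integrable.comp_sub_left τ).symm.neg
    simp only [sub_zero, sub_self] at this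
    exact this
  · rw [intervalIntegral.integral_neg, intervalIntegral.integral_comp_sub_left (fun s => h s) τ,
      H.eq_add τ ⟨hτ, le_rfl⟩, H.eq_add (τ - t) ⟨by linarith [ht.2], by linarith [ht.1]⟩,
      sub_zero]
    have h1 : ∀ a b, a ∈ Icc 0 τ → b ∈ Icc 0 τ → IntervalIntegrable h volume a b := by
      intro a b ha hb
      refine H.integrable.mono_set ?_
      rw [uIcc_of_le hτ]
      exact uIcc_subset_Icc ha hb
    rw [← intervalIntegral.integral_add_adjacent_intervals
      (h1 0 (τ - t) ⟨le_rfl, hτ⟩ ⟨by linarith [ht.2], by linarith [ht.1]⟩)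
      (h1 (τ - t) τ ⟨by linarith [ht.2], by linarith [ht.1]⟩ ⟨hτ, le_rfl⟩)]
    abel

lemma norm_sub_le (H : IsPrimitiveOn τ x q h) {C : ℝ} (hC : ∀ s, ‖h s‖ ≤ C) {t : ℝ}
    (ht : t ∈ Icc 0 τ) : ‖q t - x‖ ≤ C * t := by
  rw [H.eq_add t ht, add_sub_cancel_left]
  have := intervalIntegral.norm_integral_le_of_norm_le_const (a := 0) (b := t) (f := h)
    (fun s _ => hC s)
  rwa [sub_zero, abs_of_nonneg ht.1] at this

lemma clm_comp [CompleteSpace X] [CompleteSpace Y] (H : IsPrimitiveOn τ x q h)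
    (Λ : X →L[ℝ] Y) :
    IsPrimitiveOn τ (Λ x) (fun s => Λ (q s)) (fun s => Λ (h s)) := by
  refine ⟨⟨Λ.integrable_comp H.integrable.1, Λ.integrable_comp H.integrable.2⟩, fun t ht => ?_⟩
  rw [H.eq_add t ht, map_add]
  congr 1
  exact (Λ.intervalIntegral_comp_comm (H.mono ht.1 ht.2).integrable).symm

end IsPrimitiveOn

/-- Local solution of an autonomous Lipschitz equation, on a time interval that depends only on
the Lipschitz constant. -/
lemma exists_isPrimitiveOn_of_lipschitz [CompleteSpace X] {v : X → X} {K : ℝ≥0}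
    (hv : LipschitzWith K v) {δ : ℝ} (hδ : 0 ≤ δ) (hKδ : K * δ ≤ 1 / 2) (p : X) :
    ∃ q : ℝ → X, IsPrimitiveOn δ p q (fun s => v (q s)) ∧
      (∀ t, ‖q t - p‖ ≤ 2 * ‖v p‖ * δ) ∧
      ‖q δ - p - δ • v p‖ ≤ 2 * K * ‖v p‖ * δ ^ 2 := by
  let t₀ : Icc (0 : ℝ) δ := ⟨0, le_rfl, hδ⟩
  obtain ⟨r, hr⟩ : ∃ r : ℝ≥0, (r : ℝ) = 2 * ‖v p‖ * δ := ⟨⟨2 * ‖v p‖ * δ, by positivity⟩, rfl⟩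
  -- The radius `2‖v p‖δ` closes up: on that ball `‖v‖ ≤ ‖v p‖ + Kδ · 2‖v p‖ ≤ 2‖v p‖`, because `Kδ
  -- ≤ 1/2`.
  have hPL : IsPicardLindelof (fun _ => v) t₀ p r 0 (2 * ‖v p‖₊) K := by
    refine IsPicardLindelof.of_time_independent (fun y hy => ?_) hv.lipschitzOnWith ?_
    · have h1 : ‖v y - v p‖ ≤ K * ‖y - p‖ := hv.norm_sub_le y p
      have h2 : ‖y - p‖ ≤ 2 * ‖v p‖ * δ := by simpa [dist_eq_norm, hr] using hy
      have h3 : ‖v y‖ ≤ ‖v y - v p‖ + ‖v p‖ := by simpa using norm_add_le (v y - v p) (v p)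
      have h4 : K * ‖y - p‖ ≤ K * (2 * ‖v p‖ * δ) := by gcongr
      have h5 : (K * δ) * (2 * ‖v p‖) ≤ 1 / 2 * (2 * ‖v p‖) := by gcongr
      simp only [NNReal.coe_mul, NNReal.coe_ofNat, coe_nnnorm]
      nlinarith
    · simp [t₀, hδ, hr]
  have hp : p ∈ Metric.closedBall p ((0 : ℝ≥0) : ℝ) := by simp
  obtain ⟨α, hα⟩ := ODE.FunSpace.exists_isFixedPt_next hPL hp
  have hball : ∀ t, ‖α.compProj t - p‖ ≤ 2 * ‖v p‖ * δ := fun t => by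
    simpa [dist_eq_norm, hr] using α.compProj_mem_closedBall hPL.mul_max_le (t := t)
  have hcont : Continuous fun s => v (α.compProj s) := hv.continuous.comp α.continuous_compProj
  have hprim : IsPrimitiveOn δ p α.compProj (fun s => v (α.compProj s)) := by
    refine ⟨hcont.intervalIntegrable _ _, fun t ht => ?_⟩
    rw [ODE.FunSpace.compProj_of_mem ht, (ODE.FunSpace.isFixedPt_next_iff hPL hp).1 hα]
    rfl
  refine ⟨α.compProj, hprim, hball, ?_⟩
  have h1 : α.compProj δ - p - δ • v p = ∫ s in (0 : ℝ)..δ, (v (α.compProj s) - v p) := by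
    rw [intervalIntegral.integral_sub (hcont.intervalIntegrable _ _) (by simp),
      hprim.eq_add δ ⟨hδ, le_rfl⟩]
    simp
  rw [h1]
  have h2 := intervalIntegral.norm_integral_le_of_norm_le_const (a := 0) (b := δ)
    (f := fun s => v (α.compProj s) - v p) (C := K * (2 * ‖v p‖ * δ)) (fun s _ =>
      (hv.norm_sub_le _ _).trans (by gcongr; exact hball s))
  rw [sub_zero, abs_of_nonneg hδ] at h2
  calc _ ≤ _ := h2
    _ = _ := by ring

lemma floor_add_div {δ : ℝ} (hδ : 0 < δ) (n : ℕ) {s : ℝ} (hs : s ∈ Ico 0 δ) :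
    ⌊(n * δ + s) / δ⌋₊ = n := by
  rw [add_div, mul_div_cancel_right₀ _ hδ.ne', add_comm,
    Nat.floor_add_natCast (div_nonneg hs.1 hδ.le)]
  have : ⌊s / δ⌋₊ = 0 := Nat.floor_eq_zero.2 ((div_lt_one hδ).2 hs.2)
  omega

/-- Solutions on successive intervals of the same length glue to a solution on `[0, +∞)`. -/
lemma exists_glue {δ : ℝ} (hδ : 0 < δ) (P : ℕ → X) (q h : ℕ → ℝ → X)
    (H : ∀ n, IsPrimitiveOn δ (P n) (q n) (h n)) (hP : ∀ n, P (n + 1) = q n δ) :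
    ∃ Q : ℝ → X, (∀ n : ℕ, ∀ s ∈ Icc 0 δ, Q (n * δ + s) = q n s) ∧
      ∀ τ, 0 ≤ τ → IsPrimitiveOn τ (P 0) Q (fun s => h ⌊s / δ⌋₊ (s - ⌊s / δ⌋₊ * δ)) := by
  let Q : ℝ → X := fun s => q ⌊s / δ⌋₊ (s - ⌊s / δ⌋₊ * δ)
  have hQ1 : ∀ n : ℕ, ∀ s ∈ Ico 0 δ, Q (n * δ + s) = q n s := fun n s hs => by
    simp only [Q, floor_add_div hδ n hs, add_sub_cancel_left]
  -- At `s = δ` the floor has already jumped to `n + 1`; the matching condition `hP` gives the value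
  -- there.
  have hQ : ∀ n : ℕ, ∀ s ∈ Icc 0 δ, Q (n * δ + s) = q n s := fun n s hs => by
    rcases hs.2.lt_or_eq with h1 | rfl
    · exact hQ1 n s ⟨hs.1, h1⟩
    · have := hQ1 (n + 1) 0 ⟨le_rfl, hδ⟩
      rw [(H _).apply_zero hδ.le, hP n] at this
      rw [← this]
      congr 1
      push_cast
      ring
  refine ⟨Q, hQ, ?_⟩
  have key : ∀ n : ℕ, IsPrimitiveOn (n * δ) (P 0) Q
      (fun s => h ⌊s / δ⌋₊ (s - ⌊s / δ⌋₊ * δ)) := by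
    intro n
    induction n with
    | zero =>
      refine ⟨by simp, fun t ht => ?_⟩
      have ht0 : t = 0 := le_antisymm (by simpa using ht.2) ht.1
      have := hQ 0 0 ⟨le_rfl, hδ.le⟩
      rw [(H 0).apply_zero hδ.le] at this
      simpa [ht0] using this
    | succ n ih =>
      have e : ((n + 1 : ℕ) : ℝ) * δ = n * δ + δ := by push_cast; ring
      rw [e]
      refine ih.concat (by positivity) hδ.le ?_
      have e2 : Q (n * δ) = P n := by
        have := hQ n 0 ⟨le_rfl, hδ.le⟩
        rwa [add_zero, (H n).apply_zero hδ.le] at this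
      rw [e2]
      refine (H n).congr hδ.le (fun s hs => hQ n s hs) (fun s hs => ?_)
      simp only [floor_add_div hδ n hs, add_sub_cancel_left]
  intro τ hτ
  obtain ⟨n, hn⟩ := exists_nat_ge (τ / δ)
  exact (key n).mono hτ ((div_le_iff₀ hδ).1 hn)

/-- Sampled feedback: at each time `n δ` the control is chosen according to the current state and
kept during a time `δ`. -/
lemma exists_sampled_feedback [CompleteSpace X] {A : Type*} {v : A → X → X} {K : ℝ≥0}
    (hv : ∀ a, LipschitzWith K (v a)) {δ : ℝ} (hδ : 0 < δ) (hKδ : K * δ ≤ 1 / 2)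
    (κ : X → A) (p : X) :
    ∃ (a : ℕ → A) (Q : ℝ → X),
      (∀ τ, 0 ≤ τ → IsPrimitiveOn τ p Q (fun s => v (a ⌊s / δ⌋₊) (Q s))) ∧
      (∀ n : ℕ, a n = κ (Q (n * δ))) ∧
      (∀ n : ℕ, ∀ s ∈ Icc 0 δ, ‖Q (n * δ + s) - Q (n * δ)‖ ≤ 2 * ‖v (a n) (Q (n * δ))‖ * δ) ∧
      ∀ n : ℕ, ‖Q (n * δ + δ) - Q (n * δ) - δ • v (a n) (Q (n * δ))‖ ≤
        2 * K * ‖v (a n) (Q (n * δ))‖ * δ ^ 2 := by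
  choose φ h1 h2 h3 using fun (a : A) (p : X) =>
    exists_isPrimitiveOn_of_lipschitz (hv a) hδ.le hKδ p
  let P : ℕ → X := fun n => Nat.rec p (fun _ z => φ (κ z) z δ) n
  obtain ⟨Q, hQ, hQ'⟩ := exists_glue hδ P (fun n => φ (κ (P n)) (P n))
    (fun n s => v (κ (P n)) (φ (κ (P n)) (P n) s)) (fun n => h1 _ _) (fun n => rfl)
  have hQP : ∀ n : ℕ, Q (n * δ) = P n := fun n => by
    have := hQ n 0 ⟨le_rfl, hδ.le⟩
    rwa [add_zero, (h1 _ _).apply_zero hδ.le] at this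
  refine ⟨fun n => κ (P n), Q, fun τ hτ => ?_, fun n => by rw [hQP], fun n s hs => ?_,
    fun n => ?_⟩
  · refine (hQ' τ hτ).congr hτ (fun _ _ => rfl) (fun s hs => ?_)
    have e1 : (⌊s / δ⌋₊ : ℝ) * δ ≤ s :=
      (le_div_iff₀ hδ).1 (Nat.floor_le (div_nonneg hs.1 hδ.le))
    have e2 : s < (⌊s / δ⌋₊ + 1 : ℝ) * δ := (div_lt_iff₀ hδ).1 (Nat.lt_floor_add_one _)
    have := hQ ⌊s / δ⌋₊ (s - ⌊s / δ⌋₊ * δ) ⟨by linarith, by linarith⟩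
    rw [add_sub_cancel] at this
    simp only [this]
  · rw [hQP, hQ n s hs]
    exact h2 _ _ _
  · rw [hQP, hQ n δ ⟨hδ.le, le_rfl⟩]
    exact h3 _ _

end Primitive

end SingPert

/-! ### Uniform descent and regulation of the fast variable -/

namespace SingPert

open Set
open scoped RealInnerProductSpace

section Dynamics

variable {N M : ℕ} {A : Type*} {f : E N → E M → A → E N} {g : E N → E M → A → E M}

/-- Locally uniformly in the state, every direction of the fast space can be descended at a
positive rate with a velocity of bounded norm. -/
def UniformDescent (g : E N → E M → A → E M) : Prop :=
  ∀ K : Set (E N × E M), IsCompact K → ∃ r : ℝ, 0 < r ∧ ∃ G : ℝ, ∀ p ∈ K, ∀ v : E M,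
    ∃ a, ⟪v, g p.1 p.2 a⟫ ≤ -r * ‖v‖ ∧ ‖g p.1 p.2 a‖ ≤ G

lemma UniformDescent.neg (h : UniformDescent g) : UniformDescent (fun x y a => -g x y a) := by
  intro K hK
  obtain ⟨r, hr, G, hG⟩ := h K hK
  refine ⟨r, hr, G, fun p hp v => ?_⟩
  obtain ⟨a, h1, h2⟩ := hG p hp (-v)
  exact ⟨a, by simpa using h1, by simpa using h2⟩

lemma DynamicsAssumption.neg (h : DynamicsAssumption f g) :
    DynamicsAssumption (fun x y a => -f x y a) (fun x y a => -g x y a) := by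
  obtain ⟨⟨L, hL, h1⟩, Q, h2⟩ := h
  refine ⟨⟨L, hL, fun x₁ x₂ y₁ y₂ a => ?_⟩, Q, fun x y a => by simpa using h2 x y a⟩
  have e : ∀ {n : ℕ} (u w : E n), ‖-u - -w‖ = ‖u - w‖ := fun u w => by
    rw [← norm_neg]; congr 1; abel
  rw [e, e]
  exact h1 x₁ x₂ y₁ y₂ a

lemma DynamicsAssumption.continuous_fast (h : DynamicsAssumption f g) (a : A) :
    Continuous fun p : E N × E M => g p.1 p.2 a := by
  obtain ⟨⟨L, hL, h1⟩, -⟩ := h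
  refine (LipschitzWith.of_dist_le_mul (K := (2 * L).toNNReal) fun p p' => ?_).continuous
  rw [dist_eq_norm, dist_eq_norm, Real.coe_toNNReal _ (by positivity)]
  have h2 := norm_fst_le (p - p')
  have h3 := norm_snd_le (p - p')
  have h4 := (h1 p.1 p'.1 p.2 p'.2 a).2
  simp only [Prod.fst_sub, Prod.snd_sub] at h2 h3
  nlinarith

/-- If every velocity lay in the half-space `⟪v, ·⟫ ≥ -r/4`, so would the closed convex hull, which
contains `-(r/2) v`. A control good at one state and direction stays good nearby, so compactness of
`K` times the unit sphere leaves finitely many controls. This yields the speed bound `G`, although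
`g` is not assumed continuous in the control. -/
lemma TotalControllability.uniformDescent (hg : TotalControllability g)
    (hfg : DynamicsAssumption f g) (hM : 0 < M) : UniformDescent g := by
  intro K hK
  obtain ⟨r, hr, hball⟩ := hg K hK
  have hpt : ∀ p ∈ K, ∀ v : E M, ‖v‖ = 1 → ∃ a, ⟪v, g p.1 p.2 a⟫ < -(r / 4) := by
    intro p hp v hv
    by_contra! hcon
    have hcl : IsClosed {z : E M | -(r / 4) ≤ ⟪v, z⟫} :=
      isClosed_le continuous_const (by fun_prop)
    have hcv : Convex ℝ {z : E M | -(r / 4) ≤ ⟪v, z⟫} :=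
      convex_halfSpace_ge (innerSL ℝ v).toLinearMap.isLinear _
    have hsub : closure (convexHull ℝ (range (g p.1 p.2))) ⊆ {z : E M | -(r / 4) ≤ ⟪v, z⟫} :=
      closure_minimal (convexHull_min (by rintro _ ⟨a, rfl⟩; exact hcon a) hcv) hcl
    have hmem : (-(r / 2)) • v ∈ Metric.ball (0 : E M) r := by
      simp only [mem_ball_zero_iff, norm_smul, hv, norm_neg, Real.norm_eq_abs, mul_one]
      rw [abs_of_pos (by positivity)]
      linarith
    have := hsub (hball p hp hmem)
    simp only [mem_ofPred_eq, inner_smul_right, real_inner_self_eq_norm_sq, hv] at this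
    linarith
  have hunif : ∃ G : ℝ, ∀ z ∈ K ×ˢ Metric.sphere (0 : E M) 1,
      ∃ a, ⟪z.2, g z.1.1 z.1.2 a⟫ ≤ -(r / 4) ∧ ‖g z.1.1 z.1.2 a‖ ≤ G := by
    refine IsCompact.induction_on (hK.prod (isCompact_sphere (0 : E M) 1)) ⟨0, by simp⟩
      (fun s t hst ⟨G, hG⟩ => ⟨G, fun z hz => hG z (hst hz)⟩)
      (fun s t ⟨G, hG⟩ ⟨G', hG'⟩ => ⟨max G G', ?_⟩) ?_
    · rintro z (hz | hz)
      · obtain ⟨a, h1, h2⟩ := hG z hz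
        exact ⟨a, h1, h2.trans (le_max_left _ _)⟩
      · obtain ⟨a, h1, h2⟩ := hG' z hz
        exact ⟨a, h1, h2.trans (le_max_right _ _)⟩
    · rintro ⟨p, v⟩ ⟨hp, hv⟩
      obtain ⟨a, ha⟩ := hpt p hp v (by simpa using hv)
      have hc : Continuous fun z : (E N × E M) × E M => g z.1.1 z.1.2 a :=
        (hfg.continuous_fast a).comp continuous_fst
      have hc1 : Continuous fun z : (E N × E M) × E M => ⟪z.2, g z.1.1 z.1.2 a⟫ :=
        continuous_snd.inner hc
      refine ⟨_, mem_nhdsWithin_of_mem_nhds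
        ((hc1.continuousAt (x := (p, v)).eventually_lt_const ha).and
          (hc.norm.continuousAt (x := (p, v)).eventually_lt_const (lt_add_one _))),
        ‖g p.1 p.2 a‖ + 1, fun z hz => ⟨a, hz.1.le, hz.2.le⟩⟩
  obtain ⟨G, hG⟩ := hunif
  refine ⟨r / 4, by positivity, G, fun p hp v => ?_⟩
  rcases eq_or_ne v 0 with rfl | hv
  · obtain ⟨a, -, h2⟩ := hG (p, EuclideanSpace.single ⟨0, hM⟩ 1) ⟨hp, by simp⟩
    exact ⟨a, by simp, h2⟩
  · have hv' : 0 < ‖v‖ := norm_pos_iff.2 hv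
    obtain ⟨a, h1, h2⟩ := hG (p, ‖v‖⁻¹ • v) ⟨hp, by simp [norm_smul, hv]⟩
    refine ⟨a, ?_, h2⟩
    simp only [inner_smul_left, RCLike.conj_to_real] at h1
    have := mul_le_mul_of_nonneg_left h1 hv'.le
    rw [mul_inv_cancel_left₀ hv'.ne'] at this
    linarith

/-- One step of the explicit Euler scheme along a descent direction. -/
lemma norm_add_smul_le_of_inner_le {V : Type*} [NormedAddCommGroup V] [InnerProductSpace ℝ V]
    {w b : V} {r G δ ρ : ℝ} (hr : 0 < r) (hδ : 0 < δ) (hw : ρ ≤ ‖w‖)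
    (hb : ‖b‖ ≤ G) (hin : ⟪w, b⟫ ≤ -r * ‖w‖) (h1 : G ^ 2 * δ ≤ r * ρ) (h2 : r * δ ≤ ρ) :
    ‖w + δ • b‖ ≤ ‖w‖ - r * δ / 2 := by
  have hrδ : 0 < r * δ := by positivity
  refine le_of_sq_le_sq ?_ (by linarith)
  rw [norm_add_sq_real, inner_smul_right, norm_smul, Real.norm_eq_abs, abs_of_pos hδ]
  have hb2 : ‖b‖ ^ 2 ≤ G ^ 2 := by gcongr
  -- The second-order term uses up at most half of the first-order gain `2δr‖w‖`, and `‖w‖² - rδ‖w‖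
  -- ≤ (‖w‖ - rδ/2)²`.
  have e1 : (δ * ‖b‖) ^ 2 ≤ δ * (r * ρ) := by
    calc (δ * ‖b‖) ^ 2 = δ * (‖b‖ ^ 2 * δ) := by ring
      _ ≤ δ * (G ^ 2 * δ) := by gcongr
      _ ≤ _ := by gcongr
  have e2 : δ * (r * ρ) ≤ δ * (r * ‖w‖) := by gcongr
  have e3 : δ * ⟪w, b⟫ ≤ δ * (-r * ‖w‖) := by gcongr
  nlinarith [sq_nonneg (r * δ)]

lemma norm_slow_sub_le {τ ε Q : ℝ} {x : E N} {ξ : ℝ → E N} {η : ℝ → E M} {α : ℝ → A}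
    (hε : 0 ≤ ε) (hQ : ∀ x y a, ‖f x y a‖ ≤ Q)
    (hξ : IsPrimitiveOn τ x ξ (fun s => ε • f (ξ s) (η s) (α s))) (x₀ : E N) {s : ℝ}
    (hs : s ∈ Icc 0 τ) : ‖ξ s - x₀‖ ≤ ‖x - x₀‖ + ε * Q * s := by
  have h1 := hξ.norm_sub_le (C := ε * Q) (fun u => by
    rw [norm_smul, Real.norm_of_nonneg hε]
    gcongr
    exact hQ _ _ _) hs
  have h2 := norm_add_le (ξ s - x) (x - x₀)
  rw [sub_add_sub_cancel] at h2
  linarith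

/-- Regulation of the fast variable: there are controls which bring it near a given point in a
bounded time, and which keep it there as long as the slow variable stays in a given ball. -/
lemma exists_regulated [MeasurableSpace A] (hfg : DynamicsAssumption f g) (hg : UniformDescent g)
    {Q : ℝ} (hQ : ∀ x y a, ‖f x y a‖ ≤ Q) (x₀ : E N) (Rx : ℝ) (z₀ : E M) {D ρ : ℝ}
    (hD : 0 ≤ D) (hρ : 0 < ρ) :
    ∃ T : ℝ, 0 ≤ T ∧ ∀ ε : ℝ, 0 < ε → ε ≤ 1 → ∀ (x : E N) (y : E M), ‖y - z₀‖ ≤ D →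
      ∃ (α : ℝ → A) (ξ : ℝ → E N) (η : ℝ → E M), Measurable α ∧
        (∀ τ, 0 ≤ τ → IsPrimitiveOn τ x ξ (fun s => ε • f (ξ s) (η s) (α s))) ∧
        (∀ τ, 0 ≤ τ → IsPrimitiveOn τ y η (fun s => g (ξ s) (η s) (α s))) ∧
        ∀ s, 0 ≤ s → ‖x - x₀‖ + ε * Q * s ≤ Rx →
          ‖η s - z₀‖ ≤ D + 3 * ρ ∧ (T ≤ s → ‖η s - z₀‖ ≤ 3 * ρ) := by
  obtain ⟨⟨L, hL, hLip⟩, -⟩ := id hfg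
  let K : Set (E N × E M) := Metric.closedBall x₀ Rx ×ˢ Metric.closedBall z₀ (D + 2 * ρ)
  have hK : IsCompact K := (isCompact_closedBall _ _).prod (isCompact_closedBall _ _)
  obtain ⟨r, hr, G, hG⟩ := hg K hK
  have : Nonempty A := by
    obtain ⟨_, _, _, h⟩ := hg {(0, 0)} isCompact_singleton
    exact ⟨(h _ rfl 0).choose⟩
  have hQ0 : 0 ≤ Q := (norm_nonneg _).trans (hQ x₀ z₀ (Classical.arbitrary A))
  obtain ⟨Λ, hΛ⟩ : ∃ Λ : ℝ≥0, (Λ : ℝ) = 2 * L := ⟨⟨2 * L, by positivity⟩, rfl⟩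
  let H : ℝ := max Q G
  have hH0 : 0 ≤ H := hQ0.trans (le_max_left _ _)
  -- In order: local solvability, displacement at most `ρ` per step, Euler descent, deviation from
  -- the Euler step at most `rδ/4`, Euler descent again. Since `ε ≤ 1`, the constants `Λ` and `H`
  -- serve for every `ε`, and so does `δ`.
  obtain ⟨δ, hδ, hδ1, hδ2, hδ3, hδ4, hδ5⟩ : ∃ δ : ℝ, 0 < δ ∧ Λ * δ ≤ 1 / 2 ∧ 2 * H * δ ≤ ρ ∧
      H ^ 2 * δ ≤ r * ρ ∧ 8 * Λ * H * δ ≤ r ∧ r * δ ≤ ρ := by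
    have key : ∀ c d : ℝ, 0 < d → ∀ᶠ δ in 𝓝[>] (0 : ℝ), c * δ ≤ d := fun c d hd => by
      have : Tendsto (fun δ : ℝ => c * δ) (𝓝[>] 0) (𝓝 (c * 0)) :=
        ((continuous_const_mul c).tendsto 0).mono_left nhdsWithin_le_nhds
      rw [mul_zero] at this
      exact (this.eventually_lt_const hd).mono fun _ h => h.le
    exact (eventually_mem_nhdsWithin.and ((key _ _ (by norm_num)).and ((key _ _ hρ).and
      ((key _ _ (by positivity)).and ((key _ _ hr).and (key _ _ hρ)))))).exists
  have hrδ : 0 < r * δ := by positivity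
  -- Each step gains `rδ/4`, so `D` is used up after `4D/r`; the extra `δ` covers rounding down to a
  -- sampling time.
  refine ⟨4 * D / r + δ, by positivity, fun ε hε hε1 x y hy => ?_⟩
  let v : A → E N × E M → E N × E M := fun a p => (ε • f p.1 p.2 a, g p.1 p.2 a)
  have hv : ∀ a, LipschitzWith Λ (v a) := fun a => LipschitzWith.of_dist_le_mul fun p p' => by
    rw [dist_eq_norm, dist_eq_norm, hΛ]
    have h2 := norm_fst_le (p - p')
    have h3 := norm_snd_le (p - p')
    have h4 := hLip p.1 p'.1 p.2 p'.2 a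
    simp only [Prod.fst_sub, Prod.snd_sub] at h2 h3
    have h5 : L * (‖p.1 - p'.1‖ + ‖p.2 - p'.2‖) ≤ 2 * L * ‖p - p'‖ := by nlinarith
    refine norm_prod_le_iff.2 ⟨?_, h4.2.trans h5⟩
    simp only [v, Prod.fst_sub]
    rw [← smul_sub, norm_smul, Real.norm_of_nonneg hε.le]
    nlinarith [norm_nonneg (f p.1 p.2 a - f p'.1 p'.2 a), h4.1.trans h5]
  have hκ : ∀ p : E N × E M, ∃ a, p ∈ K → ⟪p.2 - z₀, g p.1 p.2 a⟫ ≤ -r * ‖p.2 - z₀‖ ∧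
      ‖g p.1 p.2 a‖ ≤ G := fun p => by
    by_cases hp : p ∈ K
    · obtain ⟨a, ha⟩ := hG p hp (p.2 - z₀)
      exact ⟨a, fun _ => ha⟩
    · exact ⟨Classical.arbitrary A, fun h => absurd h hp⟩
  choose κ hκ using hκ
  obtain ⟨a, q, hq, ha, hq1, hq2⟩ := exists_sampled_feedback hv hδ hδ1 κ (x, y)
  have hslow : ∀ τ, 0 ≤ τ → IsPrimitiveOn τ x (fun s => (q s).1)
      (fun s => ε • f (q s).1 (q s).2 (a ⌊s / δ⌋₊)) := fun τ hτ =>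
    (hq τ hτ).clm_comp (ContinuousLinearMap.fst ℝ (E N) (E M))
  have hfast : ∀ τ, 0 ≤ τ → IsPrimitiveOn τ y (fun s => (q s).2)
      (fun s => g (q s).1 (q s).2 (a ⌊s / δ⌋₊)) := fun τ hτ =>
    (hq τ hτ).clm_comp (ContinuousLinearMap.snd ℝ (E N) (E M))
  have hslowb : ∀ s, 0 ≤ s → ‖(q s).1 - x₀‖ ≤ ‖x - x₀‖ + ε * Q * s := fun s hs =>
    norm_slow_sub_le hε.le hQ (hslow s hs) x₀ ⟨hs, le_rfl⟩
  have hvb : ∀ n : ℕ, q (n * δ) ∈ K → ‖v (a n) (q (n * δ))‖ ≤ H := fun n hn => by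
    refine norm_prod_le_iff.2 ⟨?_, ?_⟩
    · simp only [v]
      rw [norm_smul, Real.norm_of_nonneg hε.le]
      have := hQ (q (n * δ)).1 (q (n * δ)).2 (a n)
      exact le_trans (by nlinarith [norm_nonneg (f (q (n * δ)).1 (q (n * δ)).2 (a n))])
        (le_max_left Q G)
    · rw [ha]
      exact ((hκ _ hn).2).trans (le_max_right _ _)
  have hstep : ∀ n : ℕ, q (n * δ) ∈ K → ∀ s ∈ Icc 0 δ,
      ‖(q (n * δ + s)).2 - (q (n * δ)).2‖ ≤ ρ := fun n hn s hs => by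
    have h1 := norm_snd_le (q (n * δ + s) - q (n * δ))
    have h2 := hq1 n s hs
    have h3 := hvb n hn
    rw [Prod.snd_sub] at h1
    have h4 : 2 * ‖v (a n) (q (n * δ))‖ * δ ≤ 2 * H * δ := by gcongr
    linarith
  -- At distance at least `ρ`, a step gains `rδ/2` by Euler and loses at most `rδ/4` to the
  -- deviation. At distance at most `ρ`, it ends within `2ρ`. Either way the state remains in `K`
  -- while the slow bound holds.
  have hinv : ∀ n : ℕ, ‖x - x₀‖ + ε * Q * (n * δ) ≤ Rx →
      ‖(q (n * δ)).2 - z₀‖ ≤ max (D - n * (r * δ / 4)) (2 * ρ) := by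
    intro n
    induction n with
    | zero =>
      intro _
      have := (hq 0 le_rfl).apply_zero le_rfl
      simp [this, hy]
    | succ n ih =>
      intro hn
      have hn0 : 0 ≤ (n : ℝ) * δ := by positivity
      have hn' : ‖x - x₀‖ + ε * Q * (n * δ) ≤ Rx := by
        refine le_trans ?_ hn
        push_cast
        gcongr
        linarith
      have hw := ih hn'
      have hwD : ‖(q (n * δ)).2 - z₀‖ ≤ D + 2 * ρ := hw.trans (max_le (by
        have : 0 ≤ n * (r * δ / 4) := by positivity
        linarith) (by linarith))
      have hKn : q (n * δ) ∈ K := by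
        refine ⟨?_, ?_⟩
        · rw [mem_closedBall_iff_norm]; exact (hslowb _ hn0).trans hn'
        · rw [mem_closedBall_iff_norm]; exact hwD
      have e : ((n + 1 : ℕ) : ℝ) * δ = n * δ + δ := by push_cast; ring
      rw [e]
      rcases le_total ρ ‖(q (n * δ)).2 - z₀‖ with hρw | hρw
      · have h1 := hκ _ hKn
        rw [← ha] at h1
        have h2 := norm_add_smul_le_of_inner_le hr hδ hρw (h1.2.trans (le_max_right Q G)) h1.1
          hδ3 hδ5
        have h3 := (norm_snd_le _).trans (hq2 n)
        have h4 : 2 * Λ * ‖v (a n) (q (n * δ))‖ * δ ^ 2 ≤ 2 * Λ * H * δ ^ 2 := by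
          gcongr
          exact hvb n hKn
        have h5 : 2 * Λ * H * δ ^ 2 ≤ r * δ / 4 := by nlinarith
        have h6 := norm_add_le ((q (n * δ)).2 - z₀ + δ • g (q (n * δ)).1 (q (n * δ)).2 (a n))
          (q (n * δ + δ) - q (n * δ) - δ • v (a n) (q (n * δ))).2
        have h7 : (q (n * δ)).2 - z₀ + δ • g (q (n * δ)).1 (q (n * δ)).2 (a n) +
            (q (n * δ + δ) - q (n * δ) - δ • v (a n) (q (n * δ))).2 =
            (q (n * δ + δ)).2 - z₀ := by
          simp only [v, Prod.snd_sub, Prod.smul_snd]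
          abel
        rw [h7] at h6
        rcases le_max_iff.1 hw with h8 | h8
        · refine le_max_of_le_left ?_
          push_cast
          linarith
        · refine le_max_of_le_right ?_
          linarith
      · refine le_max_of_le_right ?_
        have h1 := hstep n hKn δ ⟨hδ.le, le_rfl⟩
        have h2 := norm_add_le ((q (n * δ + δ)).2 - (q (n * δ)).2) ((q (n * δ)).2 - z₀)
        rw [sub_add_sub_cancel] at h2
        linarith
  refine ⟨fun s => a ⌊s / δ⌋₊, fun s => (q s).1, fun s => (q s).2, ?_, hslow, hfast,
    fun s hs hsR => ?_⟩
  · exact (measurable_from_nat (f := a)).comp (Nat.measurable_floor.comp (measurable_id.div_const δ))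
  · set n := ⌊s / δ⌋₊ with hn
    have e1 : (n : ℝ) * δ ≤ s := (le_div_iff₀ hδ).1 (Nat.floor_le (div_nonneg hs hδ.le))
    have e2 : s < (n + 1 : ℝ) * δ := (div_lt_iff₀ hδ).1 (Nat.lt_floor_add_one _)
    have hn0 : 0 ≤ (n : ℝ) * δ := by positivity
    have hnR : ‖x - x₀‖ + ε * Q * (n * δ) ≤ Rx := le_trans (by gcongr) hsR
    have hw := hinv n hnR
    have hwD : ‖(q (n * δ)).2 - z₀‖ ≤ D + 2 * ρ := hw.trans (max_le (by
      have : 0 ≤ n * (r * δ / 4) := by positivity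
      linarith) (by linarith))
    have hKn : q (n * δ) ∈ K := by
      refine ⟨?_, ?_⟩
      · rw [mem_closedBall_iff_norm]; exact (hslowb _ hn0).trans hnR
      · rw [mem_closedBall_iff_norm]; exact hwD
    have h1 := hstep n hKn (s - n * δ) ⟨by linarith, by linarith⟩
    rw [add_sub_cancel] at h1
    have h2 := norm_add_le ((q s).2 - (q (n * δ)).2) ((q (n * δ)).2 - z₀)
    rw [sub_add_sub_cancel] at h2
    refine ⟨by linarith, fun hT => ?_⟩
    have h3 : D - n * (r * δ / 4) ≤ 0 := by
      have h4 : 4 * D / r ≤ n * δ := by linarith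
      rw [div_le_iff₀ hr] at h4
      linarith
    have h5 : ‖(q (n * δ)).2 - z₀‖ ≤ 2 * ρ := hw.trans (max_le (by linarith) le_rfl)
    linarith

end Dynamics

end SingPert

/-! ### Weak semilimits as `liminf` and `limsup` along a filter -/

namespace SingPert

open Set

section Semilimit

variable {X : Type*} [TopologicalSpace X] {u : ℝ → X → EReal} {p p' : X}

lemma tendsto_nhdsGT_prod {ε : ℕ → ℝ} {q : ℕ → X} (h1 : ∀ n, 0 < ε n)
    (h2 : Tendsto ε atTop (𝓝 0)) (h3 : Tendsto q atTop (𝓝 p)) :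
    Tendsto (fun n => (ε n, q n)) atTop (𝓝[>] 0 ×ˢ 𝓝 p) :=
  (tendsto_nhdsWithin_iff.2 ⟨h2, Eventually.of_forall h1⟩).prodMk h3

lemma exists_seq_of_frequently [FirstCountableTopology X] {P : ℝ × X → Prop}
    (h : ∃ᶠ z in 𝓝[>] 0 ×ˢ 𝓝 p, P z) :
    ∃ (ε : ℕ → ℝ) (q : ℕ → X), (∀ n, 0 < ε n) ∧ Tendsto ε atTop (𝓝 0) ∧
      Tendsto q atTop (𝓝 p) ∧ ∀ n, P (ε n, q n) := by
  have hpos : ∀ᶠ z : ℝ × X in 𝓝[>] 0 ×ˢ 𝓝 p, 0 < z.1 :=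
    tendsto_fst.eventually eventually_mem_nhdsWithin
  obtain ⟨z, hz, hP⟩ := exists_seq_forall_of_frequently (h.and_eventually hpos)
  exact ⟨fun n => (z n).1, fun n => (z n).2, fun n => (hP n).2,
    (tendsto_fst.comp hz).mono_right nhdsWithin_le_nhds, tendsto_snd.comp hz, fun n => (hP n).1⟩

lemma lowerSemilimit_eq_liminf [FirstCountableTopology X] :
    lowerSemilimit u p = liminf (fun z : ℝ × X => u z.1 z.2) (𝓝[>] 0 ×ˢ 𝓝 p) := by
  apply le_antisymm
  · refine le_of_forall_gt_imp_ge_of_dense fun c hc => ?_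
    obtain ⟨ε, q, h1, h2, h3, h4⟩ := exists_seq_of_frequently (frequently_lt_of_liminf_lt
      (by isBoundedDefault) hc)
    have h5 : lowerSemilimit u p ≤ liminf (fun n => u (ε n) (q n)) atTop :=
      sInf_le ⟨ε, q, h1, h2, h3, rfl⟩
    exact h5.trans
      (liminf_le_of_frequently_le' (Frequently.of_forall fun n => (h4 n).le))
  · refine le_sInf ?_
    rintro _ ⟨ε, q, h1, h2, h3, rfl⟩
    exact liminf_le_liminf_of_le (u := fun z : ℝ × X => u z.1 z.2) (tendsto_nhdsGT_prod h1 h2 h3)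

lemma upperSemilimit_eq_limsup [FirstCountableTopology X] :
    upperSemilimit u p = limsup (fun z : ℝ × X => u z.1 z.2) (𝓝[>] 0 ×ˢ 𝓝 p) := by
  apply le_antisymm
  · refine sSup_le ?_
    rintro _ ⟨ε, q, h1, h2, h3, rfl⟩
    exact limsup_le_limsup_of_le (u := fun z : ℝ × X => u z.1 z.2) (tendsto_nhdsGT_prod h1 h2 h3)
  · refine le_of_forall_lt_imp_le_of_dense fun c hc => ?_
    obtain ⟨ε, q, h1, h2, h3, h4⟩ := exists_seq_of_frequently (frequently_lt_of_lt_limsup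
      (by isBoundedDefault) hc)
    exact (le_limsup_of_frequently_le' (Frequently.of_forall fun n => (h4 n).le)).trans
      (le_sSup ⟨ε, q, h1, h2, h3, rfl⟩)

lemma lowerSemilimit_le_upperSemilimit [FirstCountableTopology X] :
    lowerSemilimit u p ≤ upperSemilimit u p := by
  rw [lowerSemilimit_eq_liminf, upperSemilimit_eq_limsup]
  exact liminf_le_limsup

/-- Any real `b₁ > b` below `u` near `p'` forces `b` below `u` near `p`, by taking the loss `c = b₁
- b`. The point `q` need not converge; it only has to enter each prescribed neighbourhood. -/
lemma lowerSemilimit_le_of_near [FirstCountableTopology X]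
    (h : ∀ U ∈ 𝓝 p', ∀ c : ℝ, 0 < c →
      ∀ᶠ z : ℝ × X in 𝓝[>] 0 ×ˢ 𝓝 p, ∃ q ∈ U, u z.1 q ≤ u z.1 z.2 + c) :
    lowerSemilimit u p' ≤ lowerSemilimit u p := by
  simp only [lowerSemilimit_eq_liminf]
  refine le_of_forall_lt_imp_le_of_dense fun b hb => ?_
  obtain ⟨b₁, hb₁, hb₁'⟩ := EReal.lt_iff_exists_real_btwn.1 hb
  rcases eq_bot_or_bot_lt b with rfl | hbot
  · exact bot_le
  lift b to ℝ using ⟨(hb₁.trans (EReal.coe_lt_top _)).ne, hbot.ne'⟩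
  obtain ⟨S, hS, U, hU, hSU⟩ := mem_prod_iff.1 (eventually_lt_of_lt_liminf hb₁')
  refine le_liminf_of_le (by isBoundedDefault) ?_
  have hlt : b < b₁ := EReal.coe_lt_coe_iff.1 hb₁
  filter_upwards [h U hU (b₁ - b) (by linarith), tendsto_fst.eventually hS] with z ⟨q, hq, hle⟩ hz
  have h1 : (b₁ : EReal) < u z.1 q := hSU (mk_mem_prod hz hq)
  have h2 : ((b + (b₁ - b) : ℝ) : EReal) ≤ u z.1 z.2 + ((b₁ - b : ℝ) : EReal) := by
    rw [add_sub_cancel]; exact h1.le.trans hle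
  rw [EReal.coe_add] at h2
  exact (EReal.addLECancellable_coe _).add_le_add_iff_right.1 h2

lemma upperSemilimit_le_of_near [FirstCountableTopology X]
    (h : ∀ U ∈ 𝓝 p', ∀ c : ℝ, 0 < c →
      ∀ᶠ z : ℝ × X in 𝓝[>] 0 ×ˢ 𝓝 p, ∃ q ∈ U, u z.1 z.2 ≤ u z.1 q + c) :
    upperSemilimit u p ≤ upperSemilimit u p' := by
  simp only [upperSemilimit_eq_limsup]
  refine le_of_forall_gt_imp_ge_of_dense fun b hb => ?_
  obtain ⟨b₁, hb₁, hb₁'⟩ := EReal.lt_iff_exists_real_btwn.1 hb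
  rcases eq_top_or_lt_top b with rfl | htop
  · exact le_top
  lift b to ℝ using ⟨htop.ne, ((EReal.bot_lt_coe _).trans hb₁').ne'⟩
  obtain ⟨S, hS, U, hU, hSU⟩ := mem_prod_iff.1 (eventually_lt_of_limsup_lt hb₁)
  refine limsup_le_of_le (by isBoundedDefault) ?_
  have hlt : b₁ < b := EReal.coe_lt_coe_iff.1 hb₁'
  filter_upwards [h U hU (b - b₁) (by linarith), tendsto_fst.eventually hS] with z ⟨q, hq, hle⟩ hz
  have h1 : u z.1 q < (b₁ : EReal) := hSU (mk_mem_prod hz hq)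
  calc u z.1 z.2 ≤ u z.1 q + ((b - b₁ : ℝ) : EReal) := hle
    _ ≤ b₁ + ((b - b₁ : ℝ) : EReal) := by gcongr
    _ = b := by rw [← EReal.coe_add, add_sub_cancel]

end Semilimit

/-! ### Cost bounds and the dynamic programming inequality -/

section Value

variable {N M : ℕ} {A : Type*} {f : E N → E M → A → E N} {g : E N → E M → A → E M}
  {l : E N → E M → A → ℝ} {u₀ : E N → E M → ℝ}
  {ε τ : ℝ} {x : E N} {y : E M} {α : ℝ → A} {ξ : ℝ → E N} {η : ℝ → E M}

lemma continuousOn_Ici_of_Icc {X : Type*} [TopologicalSpace X] {q : ℝ → X}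
    (h : ∀ τ, 0 ≤ τ → ContinuousOn q (Icc 0 τ)) : ContinuousOn q (Ici 0) := by
  intro t ht
  have ht' : (0 : ℝ) ≤ t := ht
  refine (h (t + 1) (by linarith) t ⟨ht', by linarith⟩).mono_of_mem_nhdsWithin ?_
  filter_upwards [self_mem_nhdsWithin, mem_nhdsWithin_of_mem_nhds (Iic_mem_nhds (lt_add_one t))]
    with s hs hs'
  exact ⟨hs, hs'⟩

lemma isTrajectory_iff (hε : 0 < ε) : IsTrajectory f g ε α x y ξ η ↔ ∀ τ, 0 ≤ τ →
    IsPrimitiveOn τ x ξ (fun s => ε • f (ξ s) (η s) (α s)) ∧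
      IsPrimitiveOn τ y η (fun s => g (ξ s) (η s) (α s)) := by
  constructor
  · intro H τ hτ
    exact ⟨⟨(H.integrable_slow τ hτ).smul ε, fun t ht => H.slow_eq t ht.1⟩,
      ⟨H.integrable_fast τ hτ, fun t ht => H.fast_eq t ht.1⟩⟩
  · intro H
    refine ⟨continuousOn_Ici_of_Icc fun τ hτ => (H τ hτ).1.continuousOn hτ,
      continuousOn_Ici_of_Icc fun τ hτ => (H τ hτ).2.continuousOn hτ, fun t ht => ?_,
      fun t ht => (H t ht).2.integrable, fun t ht => (H t ht).1.eq_add t ⟨ht, le_rfl⟩,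
      fun t ht => (H t ht).2.eq_add t ⟨ht, le_rfl⟩⟩
    have := (H t ht).1.integrable.smul ε⁻¹
    refine this.congr_ae (Eventually.of_forall fun s => ?_)
    simp [smul_smul, hε.ne']

lemma valueFunction_le_cost [MeasurableSpace A] (hα : Measurable α) {t : ℝ≥0} (H : IsTrajectory f g ε α x y ξ η) :
    valueFunction f g l u₀ ε (x, y, t) ≤ (cost l u₀ ε t α ξ η : ℝ) :=
  sInf_le ⟨α, ξ, η, hα, H, rfl⟩

variable [TopologicalSpace A] [CompactSpace A]

lemma RunningCostAssumption.exists_bound (hl : RunningCostAssumption l) {K : Set (E N × E M)}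
    (hK : IsCompact K) : ∃ C : ℝ, 0 ≤ C ∧ ∀ p ∈ K, ∀ a, |l p.1 p.2 a| ≤ C := by
  have hK' : IsCompact (K ×ˢ (univ : Set A)) := hK.prod isCompact_univ
  have hc : Continuous fun z : (E N × E M) × A => l z.1.1 z.1.2 z.2 :=
    hl.1.comp (by fun_prop : Continuous fun z : (E N × E M) × A => (z.1.1, z.1.2, z.2))
  obtain ⟨C, hC⟩ := hK'.exists_bound_of_continuousOn hc.continuousOn
  exact ⟨max C 0, le_max_right _ _, fun p hp a =>
    (hC (p, a) ⟨hp, mem_univ _⟩).trans (le_max_left _ _)⟩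

/-- Coercivity handles large `y`, compactness the rest. -/
lemma RunningCostAssumption.exists_lower_bound (hl : RunningCostAssumption l) {B : Set (E N)}
    (hB : IsCompact B) : ∃ C : ℝ, 0 ≤ C ∧ ∀ x ∈ B, ∀ y a, -C ≤ l x y a := by
  obtain ⟨R, hR⟩ := hl.2 B hB 0
  obtain ⟨C, hC0, hC⟩ := hl.exists_bound (hB.prod (isCompact_closedBall (0 : E M) R))
  refine ⟨C, hC0, fun x hx y a => ?_⟩
  rcases le_total R ‖y‖ with h | h
  · linarith [hR y h x hx a]
  · exact neg_le_of_abs_le (hC (x, y) ⟨hx, by simpa using h⟩ a)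

variable [TopologicalSpace.PseudoMetrizableSpace A] [SecondCountableTopology A]
  [MeasurableSpace A] [BorelSpace A]

lemma RunningCostAssumption.intervalIntegrable (hl : RunningCostAssumption l) (hτ : 0 ≤ τ)
    (hα : Measurable α) (hξ : ContinuousOn ξ (Icc 0 τ)) (hη : ContinuousOn η (Icc 0 τ)) :
    IntervalIntegrable (fun s => l (ξ s) (η s) (α s)) volume 0 τ := by
  rw [intervalIntegrable_iff_integrableOn_Icc_of_le hτ]
  obtain ⟨C, -, hC⟩ := hl.exists_bound ((isCompact_Icc.image_of_continuousOn hξ).prod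
    (isCompact_Icc.image_of_continuousOn hη))
  refine Integrable.of_bound ?_ C ?_
  · exact hl.1.comp_aestronglyMeasurable ((hξ.aestronglyMeasurable measurableSet_Icc).prodMk
      ((hη.aestronglyMeasurable measurableSet_Icc).prodMk hα.stronglyMeasurable.aestronglyMeasurable))
  · filter_upwards [ae_restrict_mem measurableSet_Icc] with s hs
    exact hC (ξ s, η s) ⟨mem_image_of_mem _ hs, mem_image_of_mem _ hs⟩ _

lemma RunningCostAssumption.integral_le (hl : RunningCostAssumption l) (hτ : 0 ≤ τ)
    (hα : Measurable α) (hξ : ContinuousOn ξ (Icc 0 τ)) (hη : ContinuousOn η (Icc 0 τ)) {C : ℝ}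
    (hC : ∀ s ∈ Icc 0 τ, l (ξ s) (η s) (α s) ≤ C) :
    ∫ s in (0 : ℝ)..τ, l (ξ s) (η s) (α s) ≤ τ * C := by
  have := intervalIntegral.integral_mono_on hτ (hl.intervalIntegrable hτ hα hξ hη)
    (g := fun _ => C) (by simp) hC
  simpa using this

lemma RunningCostAssumption.le_integral (hl : RunningCostAssumption l) (hτ : 0 ≤ τ)
    (hα : Measurable α) (hξ : ContinuousOn ξ (Icc 0 τ)) (hη : ContinuousOn η (Icc 0 τ)) {C : ℝ}
    (hC : ∀ s ∈ Icc 0 τ, C ≤ l (ξ s) (η s) (α s)) :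
    τ * C ≤ ∫ s in (0 : ℝ)..τ, l (ξ s) (η s) (α s) := by
  have := intervalIntegral.integral_mono_on hτ (f := fun _ => C) (by simp)
    (hl.intervalIntegrable hτ hα hξ hη) hC
  simpa using this

/-- One inequality of the dynamic programming principle. -/
lemma valueFunction_le_add (hl : RunningCostAssumption l) (hε : 0 < ε) (hτ : 0 ≤ τ)
    (hα : Measurable α) (hξ : IsPrimitiveOn τ x ξ (fun s => ε • f (ξ s) (η s) (α s)))
    (hη : IsPrimitiveOn τ y η (fun s => g (ξ s) (η s) (α s))) {t t' : ℝ≥0}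
    (ht : (t : ℝ) = t' + ε * τ) {c : ℝ}
    (hc : ε * ∫ s in (0 : ℝ)..τ, l (ξ s) (η s) (α s) ≤ c) :
    valueFunction f g l u₀ ε (x, y, t) ≤ valueFunction f g l u₀ ε (ξ τ, η τ, t') + c := by
  refine (EReal.sub_le_iff_le_add (.inl (EReal.coe_ne_bot _)) (.inl (EReal.coe_ne_top _))).1
    (le_sInf ?_)
  rintro _ ⟨α', ξ', η', hα', H', rfl⟩
  rw [isTrajectory_iff hε] at H'
  have hξ'0 : ξ' 0 = ξ τ := (H' 0 le_rfl).1.apply_zero le_rfl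
  have hη'0 : η' 0 = η τ := (H' 0 le_rfl).2.apply_zero le_rfl
  -- Follow the given path until `τ`, then a competitor for the endpoint. The states agree at `τ`,
  -- the controls need not: hence `Icc` in `e1`, `e2` but `Ico` in `e3`.
  let β : ℝ → A := fun s => if s < τ then α s else α' (s - τ)
  let ζ : ℝ → E N := fun s => if s < τ then ξ s else ξ' (s - τ)
  let θ : ℝ → E M := fun s => if s < τ then η s else η' (s - τ)
  have hβ : Measurable β := Measurable.ite measurableSet_Iio hα
    (hα'.comp (measurable_id.sub_const τ))
  have e1 : ∀ s ∈ Icc 0 τ, ζ s = ξ s := fun s hs => by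
    rcases hs.2.lt_or_eq with h | rfl
    · simp [ζ, h]
    · simp [ζ, hξ'0]
  have e2 : ∀ s ∈ Icc 0 τ, θ s = η s := fun s hs => by
    rcases hs.2.lt_or_eq with h | rfl
    · simp [θ, h]
    · simp [θ, hη'0]
  have e3 : ∀ s ∈ Ico 0 τ, β s = α s := fun s hs => by simp [β, hs.2]
  have e4 : ∀ s, 0 ≤ s → ζ (τ + s) = ξ' s := fun s hs => by simp [ζ, hs]
  have e5 : ∀ s, 0 ≤ s → θ (τ + s) = η' s := fun s hs => by simp [θ, hs]
  have e6 : ∀ s, 0 ≤ s → β (τ + s) = α' s := fun s hs => by simp [β, hs]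
  have hcat : ∀ σ, 0 ≤ σ → IsPrimitiveOn (τ + σ) x ζ (fun s => ε • f (ζ s) (θ s) (β s)) ∧
      IsPrimitiveOn (τ + σ) y θ (fun s => g (ζ s) (θ s) (β s)) := by
    intro σ hσ
    refine ⟨(hξ.congr hτ e1 fun s hs => ?_).concat hτ hσ ?_,
      (hη.congr hτ e2 fun s hs => ?_).concat hτ hσ ?_⟩
    · simp only [e1 s ⟨hs.1, hs.2.le⟩, e2 s ⟨hs.1, hs.2.le⟩, e3 s hs]
    · rw [e1 τ ⟨hτ, le_rfl⟩]
      refine (H' σ hσ).1.congr hσ (fun s hs => e4 s hs.1) fun s hs => ?_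
      simp only [e4 s hs.1, e5 s hs.1, e6 s hs.1]
    · simp only [e1 s ⟨hs.1, hs.2.le⟩, e2 s ⟨hs.1, hs.2.le⟩, e3 s hs]
    · rw [e2 τ ⟨hτ, le_rfl⟩]
      refine (H' σ hσ).2.congr hσ (fun s hs => e5 s hs.1) fun s hs => ?_
      simp only [e4 s hs.1, e5 s hs.1, e6 s hs.1]
  have htraj : IsTrajectory f g ε β x y ζ θ := (isTrajectory_iff hε).2 fun σ hσ =>
    ⟨(hcat σ hσ).1.mono hσ (by linarith), (hcat σ hσ).2.mono hσ (by linarith)⟩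
  refine EReal.sub_le_of_le_add ((valueFunction_le_cost hβ htraj).trans ?_)
  rw [← EReal.coe_add, EReal.coe_le_coe_iff]
  have hσ : 0 ≤ (t' : ℝ) / ε := by positivity
  have htσ : (t : ℝ) / ε = τ + t' / ε := by
    rw [ht]; field_simp; ring
  have hint : IntervalIntegrable (fun s => l (ζ s) (θ s) (β s)) volume 0 (τ + t' / ε) :=
    hl.intervalIntegrable (by positivity) hβ ((hcat _ hσ).1.continuousOn (by positivity))
      ((hcat _ hσ).2.continuousOn (by positivity))
  have hint1 : IntervalIntegrable (fun s => l (ζ s) (θ s) (β s)) volume 0 τ :=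
    hint.mono_set (by
      rw [uIcc_of_le hτ, uIcc_of_le (by positivity)]
      exact Icc_subset_Icc_right (by linarith))
  have hint2 : IntervalIntegrable (fun s => l (ζ s) (θ s) (β s)) volume τ (τ + t' / ε) :=
    hint.mono_set (by
      rw [uIcc_of_le (by linarith), uIcc_of_le (by positivity)]
      exact Icc_subset_Icc_left hτ)
  have i1 : ∫ s in (0 : ℝ)..τ, l (ζ s) (θ s) (β s) = ∫ s in (0 : ℝ)..τ, l (ξ s) (η s) (α s) := by
    rw [intervalIntegral.integral_of_le hτ, intervalIntegral.integral_of_le hτ,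
      integral_Ioc_eq_integral_Ioo, integral_Ioc_eq_integral_Ioo]
    refine setIntegral_congr_fun measurableSet_Ioo fun s hs => ?_
    simp only [e1 s ⟨hs.1.le, hs.2.le⟩, e2 s ⟨hs.1.le, hs.2.le⟩, e3 s ⟨hs.1.le, hs.2⟩]
  have i2 : ∫ s in τ..(τ + t' / ε), l (ζ s) (θ s) (β s) =
      ∫ s in (0 : ℝ)..(t' / ε), l (ξ' s) (η' s) (α' s) := by
    have := intervalIntegral.integral_comp_add_left (a := 0) (b := (t' : ℝ) / ε)
      (fun s => l (ζ s) (θ s) (β s)) τ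
    rw [add_zero] at this
    rw [← this]
    refine intervalIntegral.integral_congr fun s hs => ?_
    rw [uIcc_of_le hσ] at hs
    simp only [e4 s hs.1, e5 s hs.1, e6 s hs.1]
  simp only [cost, htσ, e4 _ hσ, e5 _ hσ]
  rw [← intervalIntegral.integral_add_adjacent_intervals hint1 hint2, i1, i2]
  linarith

end Value

end SingPert

/-! ### Steering, comparison of the semilimits, finiteness -/

namespace SingPert

open Set

section Semilimits

variable {N M : ℕ} {A : Type*} {f : E N → E M → A → E N} {g : E N → E M → A → E M}
  {l : E N → E M → A → ℝ} {u₀ : E N → E M → ℝ}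

lemma eventually_mul_lt_nhdsGT (c : ℝ) {d : ℝ} (hd : 0 < d) :
    ∀ᶠ δ in 𝓝[>] (0 : ℝ), δ * c < d := by
  have : Tendsto (fun δ : ℝ => δ * c) (𝓝[>] 0) (𝓝 (0 * c)) :=
    ((continuous_mul_const c).tendsto 0).mono_left nhdsWithin_le_nhds
  rw [zero_mul] at this
  exact this.eventually_lt_const hd

lemma eventually_near (x₀ : E N) (y₀ : E M) (t₀ : ℝ≥0) {ρ : ℝ} (hρ : 0 < ρ) :
    ∀ᶠ z : ℝ × E N × E M × ℝ≥0 in 𝓝[>] 0 ×ˢ 𝓝 (x₀, y₀, t₀), 0 < z.1 ∧ z.1 < 1 ∧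
      ‖z.2.1 - x₀‖ < ρ ∧ ‖z.2.2.1 - y₀‖ < ρ ∧ |(z.2.2.2 : ℝ) - t₀| < ρ := by
  have h1 : ∀ᶠ ε in 𝓝[>] (0 : ℝ), 0 < ε ∧ ε < 1 :=
    Ioo_mem_nhdsGT one_pos
  have h2 : ∀ᶠ q : E N × E M × ℝ≥0 in 𝓝 (x₀, y₀, t₀),
      ‖q.1 - x₀‖ < ρ ∧ ‖q.2.1 - y₀‖ < ρ ∧ |(q.2.2 : ℝ) - t₀| < ρ := by
    filter_upwards [Metric.ball_mem_nhds _ hρ] with q hq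
    simp only [Metric.mem_ball, Prod.dist_eq, max_lt_iff] at hq
    refine ⟨by simpa [dist_eq_norm] using hq.1, by simpa [dist_eq_norm] using hq.2.1, ?_⟩
    exact hq.2.2
  filter_upwards [tendsto_fst.eventually h1, tendsto_snd.eventually h2] with z hz hz'
  exact ⟨hz.1, hz.2, hz'⟩

lemma exists_box_subset {x₀ : E N} {z₀ : E M} {t₀ : ℝ≥0} {U : Set (E N × E M × ℝ≥0)}
    (hU : U ∈ 𝓝 (x₀, z₀, t₀)) : ∃ ρ : ℝ, 0 < ρ ∧ ∀ (x : E N) (y : E M) (t : ℝ≥0),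
      ‖x - x₀‖ < ρ → ‖y - z₀‖ < ρ → |(t : ℝ) - t₀| < ρ → (x, y, t) ∈ U := by
  obtain ⟨ρ, hρ, h⟩ := Metric.mem_nhds_iff.1 hU
  refine ⟨ρ, hρ, fun x y t hx hy ht => h ?_⟩
  simp only [Metric.mem_ball, Prod.dist_eq, max_lt_iff]
  exact ⟨by rwa [dist_eq_norm], by rwa [dist_eq_norm], ht⟩

lemma DynamicsAssumption.exists_bound (hfg : DynamicsAssumption f g) :
    ∃ Q : ℝ, 0 ≤ Q ∧ ∀ x y a, ‖f x y a‖ ≤ Q := by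
  obtain ⟨-, Q, hQ⟩ := hfg
  exact ⟨max Q 0, le_max_right _ _, fun x y a => (hQ x y a).trans (le_max_left _ _)⟩

variable [TopologicalSpace A] [CompactSpace A] [TopologicalSpace.PseudoMetrizableSpace A]
  [SecondCountableTopology A] [MeasurableSpace A] [BorelSpace A]

/-- Steering of the fast variable in a bounded fast time, at a small cost and with a small
displacement of the slow variable. -/
lemma eventually_exists_steering (hfg : DynamicsAssumption f g) (hg : UniformDescent g)
    (hl : RunningCostAssumption l) (x₀ : E N) (y₀ z₀ : E M) (t₀ : ℝ≥0) {ρ c : ℝ}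
    (hρ : 0 < ρ) (hc : 0 < c) :
    ∃ T : ℝ, 0 ≤ T ∧ ∀ᶠ z : ℝ × E N × E M × ℝ≥0 in 𝓝[>] 0 ×ˢ 𝓝 (x₀, y₀, t₀),
      z.1 * T < ρ ∧ ∃ (α : ℝ → A) (ξ : ℝ → E N) (η : ℝ → E M), Measurable α ∧
        IsPrimitiveOn T z.2.1 ξ (fun s => z.1 • f (ξ s) (η s) (α s)) ∧
        IsPrimitiveOn T z.2.2.1 η (fun s => g (ξ s) (η s) (α s)) ∧
        ‖ξ T - x₀‖ < ρ ∧ ‖η T - z₀‖ < ρ ∧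
        z.1 * ∫ s in (0 : ℝ)..T, l (ξ s) (η s) (α s) ≤ c := by
  obtain ⟨Q, hQ0, hQ⟩ := hfg.exists_bound
  have hD : 0 ≤ ‖y₀ - z₀‖ + ρ := by positivity
  -- With `ρ/6` the final fast error is `3 · ρ/6 < ρ`. The slow radius `ρ/2` splits into `ρ/4` for
  -- the initial point and `ρ/4` for the drift `εQT`.
  obtain ⟨T, hT, hreg⟩ := exists_regulated hfg hg hQ x₀ (ρ / 2) z₀ hD
    (show 0 < ρ / 6 by positivity)
  obtain ⟨C, hC0, hC⟩ := hl.exists_bound ((isCompact_closedBall x₀ (ρ / 2)).prod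
    (isCompact_closedBall z₀ (‖y₀ - z₀‖ + ρ + 3 * (ρ / 6))))
  refine ⟨T, hT, ?_⟩
  filter_upwards [eventually_near x₀ y₀ t₀ (show 0 < ρ / 4 by positivity),
    tendsto_fst.eventually (eventually_mul_lt_nhdsGT T hρ),
    tendsto_fst.eventually (eventually_mul_lt_nhdsGT (Q * T) (show 0 < ρ / 4 by positivity)),
    tendsto_fst.eventually (eventually_mul_lt_nhdsGT (T * C) hc)]
    with ⟨ε, x, y, t⟩ ⟨hε, hε1, hx, hy, _⟩ h2 h3 h4
  simp only at hε hε1 hx hy h2 h3 h4 ⊢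
  have hyD : ‖y - z₀‖ ≤ ‖y₀ - z₀‖ + ρ := by
    have := norm_add_le (y - y₀) (y₀ - z₀)
    rw [sub_add_sub_cancel] at this
    linarith
  obtain ⟨α, ξ, η, hα, hξ, hη, hb⟩ := hreg ε hε hε1.le x y hyD
  have hR : ∀ s ∈ Icc 0 T, ‖x - x₀‖ + ε * Q * s ≤ ρ / 2 := fun s hs => by
    have : ε * Q * s ≤ ε * Q * T := by gcongr; exact hs.2
    linarith
  have hξb : ∀ s ∈ Icc 0 T, ‖ξ s - x₀‖ ≤ ρ / 2 := fun s hs =>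
    (norm_slow_sub_le hε.le hQ (hξ T hT) x₀ hs).trans (hR s hs)
  refine ⟨h2, α, ξ, η, hα, hξ T hT, hη T hT, ?_, ?_, ?_⟩
  · linarith [hξb T ⟨hT, le_rfl⟩]
  · have := (hb T hT (hR T ⟨hT, le_rfl⟩)).2 le_rfl
    linarith
  · have := hl.integral_le hT hα ((hξ T hT).continuousOn hT) ((hη T hT).continuousOn hT) (C := C)
      fun s hs => (le_abs_self _).trans (hC (ξ s, η s)
        ⟨by simpa [dist_eq_norm] using hξb s hs,
          by simpa [dist_eq_norm] using (hb s hs.1 (hR s hs)).1⟩ _)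
    have : ε * ∫ s in (0 : ℝ)..T, l (ξ s) (η s) (α s) ≤ ε * (T * C) := by gcongr
    linarith

/-- Steer forward from `z` to `q`. This spends slow time `εT`, so `t₀ > 0` is needed for the
remaining time `t - εT` to be nonnegative. -/
lemma eventually_exists_le_add (hfg : DynamicsAssumption f g) (hg : UniformDescent g)
    (hl : RunningCostAssumption l) (x₀ : E N) (y₀ z₀ : E M) {t₀ : ℝ≥0} (ht₀ : 0 < t₀)
    {U : Set (E N × E M × ℝ≥0)} (hU : U ∈ 𝓝 (x₀, z₀, t₀)) {c : ℝ} (hc : 0 < c) :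
    ∀ᶠ z : ℝ × E N × E M × ℝ≥0 in 𝓝[>] 0 ×ˢ 𝓝 (x₀, y₀, t₀), ∃ q ∈ U,
      valueFunction f g l u₀ z.1 z.2 ≤ valueFunction f g l u₀ z.1 q + c := by
  obtain ⟨ρ₀, hρ₀, hbox⟩ := exists_box_subset hU
  obtain ⟨ρ, hρ, hρ1, hρ2⟩ : ∃ ρ : ℝ, 0 < ρ ∧ 2 * ρ ≤ ρ₀ ∧ 2 * ρ ≤ t₀ :=
    ⟨min ρ₀ t₀ / 2, by positivity, by linarith [min_le_left ρ₀ (t₀ : ℝ)],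
      by linarith [min_le_right ρ₀ (t₀ : ℝ)]⟩
  obtain ⟨T, hT, hst⟩ := eventually_exists_steering hfg hg hl x₀ y₀ z₀ t₀ hρ hc
  filter_upwards [hst, eventually_near x₀ y₀ t₀ hρ] with ⟨ε, x, y, t⟩
    ⟨hεT, α, ξ, η, hα, hξ, hη, hξT, hηT, hcost⟩ ⟨hε, _, _, _, ht⟩
  simp only at hεT hξ hη hcost hε ht ⊢
  have ht' := abs_lt.1 ht
  have hεT0 : 0 ≤ ε * T := by positivity
  obtain ⟨t', ht'e⟩ : ∃ t' : ℝ≥0, (t' : ℝ) = t - ε * T := ⟨⟨t - ε * T, by linarith⟩, rfl⟩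
  refine ⟨(ξ T, η T, t'), hbox _ _ _ (by linarith) (by linarith) ?_,
    valueFunction_le_add hl hε hT hα hξ hη (by linarith) hcost⟩
  rw [abs_lt]
  constructor <;> linarith

/-- A path of the fields `-f`, `-g` from `z` to `q`, run backwards, is an admissible path from `q`
to `z` with the same cost. The horizon at `q` is the longer `t + εT`, so `t₀ = 0` is allowed. -/
lemma eventually_exists_add_le (hfg : DynamicsAssumption f g) (hg : UniformDescent g)
    (hl : RunningCostAssumption l) (x₀ : E N) (y₀ z₀ : E M) {t₀ : ℝ≥0}
    {U : Set (E N × E M × ℝ≥0)} (hU : U ∈ 𝓝 (x₀, z₀, t₀)) {c : ℝ} (hc : 0 < c) :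
    ∀ᶠ z : ℝ × E N × E M × ℝ≥0 in 𝓝[>] 0 ×ˢ 𝓝 (x₀, y₀, t₀), ∃ q ∈ U,
      valueFunction f g l u₀ z.1 q ≤ valueFunction f g l u₀ z.1 z.2 + c := by
  obtain ⟨ρ₀, hρ₀, hbox⟩ := exists_box_subset hU
  have hρ : 0 < ρ₀ / 2 := by positivity
  obtain ⟨T, hT, hst⟩ := eventually_exists_steering hfg.neg hg.neg hl x₀ y₀ z₀ t₀ hρ hc
  filter_upwards [hst, eventually_near x₀ y₀ t₀ hρ] with ⟨ε, x, y, t⟩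
    ⟨hεT, α, ξ, η, hα, hξ, hη, hξT, hηT, hcost⟩ ⟨hε, _, _, _, ht⟩
  simp only at hεT hξ hη hcost hε ht ⊢
  have ht' := abs_lt.1 ht
  have hεT0 : 0 ≤ ε * T := by positivity
  obtain ⟨t', ht'e⟩ : ∃ t' : ℝ≥0, (t' : ℝ) = t + ε * T := ⟨⟨t + ε * T, by positivity⟩, rfl⟩
  refine ⟨(ξ T, η T, t'), hbox _ _ _ (by linarith) (by linarith) ?_, ?_⟩
  · rw [abs_lt]
    constructor <;> linarith
  · have hξ' := hξ.reverse hT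
    have hη' := hη.reverse hT
    simp only [smul_neg, neg_neg] at hξ' hη'
    have key := valueFunction_le_add (u₀ := u₀) hl hε hT (hα.comp (measurable_id.const_sub T))
      hξ' hη' ht'e (c := c) (by
        have := intervalIntegral.integral_comp_sub_left (a := 0) (b := T)
          (fun s => l (ξ s) (η s) (α s)) T
        rw [sub_zero, sub_self] at this
        exact (congrArg (ε * ·) this).trans_le hcost)
    simp only [sub_self] at key
    rwa [hξ.apply_zero hT, hη.apply_zero hT] at key

lemma lowerSemilimit_valueFunction_le (hfg : DynamicsAssumption f g) (hg : UniformDescent g)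
    (hl : RunningCostAssumption l) (x₀ : E N) (y₀ z₀ : E M) (t₀ : ℝ≥0) :
    lowerSemilimit (valueFunction f g l u₀) (x₀, z₀, t₀) ≤
      lowerSemilimit (valueFunction f g l u₀) (x₀, y₀, t₀) :=
  lowerSemilimit_le_of_near fun _ hU _ hc => eventually_exists_add_le hfg hg hl x₀ y₀ z₀ hU hc

lemma upperSemilimit_valueFunction_le (hfg : DynamicsAssumption f g) (hg : UniformDescent g)
    (hl : RunningCostAssumption l) (x₀ : E N) (y₀ z₀ : E M) {t₀ : ℝ≥0} (ht₀ : 0 < t₀) :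
    upperSemilimit (valueFunction f g l u₀) (x₀, y₀, t₀) ≤
      upperSemilimit (valueFunction f g l u₀) (x₀, z₀, t₀) :=
  upperSemilimit_le_of_near fun _ hU _ hc =>
    eventually_exists_le_add hfg hg hl x₀ y₀ z₀ ht₀ hU hc

/-- Every trajectory keeps its slow part in one compact ball up to time `t/ε`, where `l ≥ -C`; the
factor `ε` turns the length `t/ε` into `t`. -/
lemma exists_coe_le_lowerSemilimit (hfg : DynamicsAssumption f g)
    (hl : RunningCostAssumption l) (hu₀ : TerminalCostAssumption u₀)
    (x₀ : E N) (y₀ : E M) (t₀ : ℝ≥0) :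
    ∃ c : ℝ, (c : EReal) ≤ lowerSemilimit (valueFunction f g l u₀) (x₀, y₀, t₀) := by
  obtain ⟨Q, hQ0, hQ⟩ := hfg.exists_bound
  obtain ⟨c₀, hc₀⟩ := hu₀.2
  obtain ⟨C, hC0, hC⟩ := hl.exists_lower_bound
    (isCompact_closedBall x₀ (1 + Q * (t₀ + 1)))
  refine ⟨-((t₀ + 1) * C) + c₀, ?_⟩
  rw [lowerSemilimit_eq_liminf]
  refine le_liminf_of_le (by isBoundedDefault) ?_
  filter_upwards [eventually_near x₀ y₀ t₀ one_pos] with ⟨ε, x, y, t⟩ ⟨hε, _, hx, _, ht⟩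
  simp only at hε hx ht ⊢
  have ht' := abs_lt.1 ht
  refine le_sInf ?_
  rintro _ ⟨α, ξ, η, hα, H, rfl⟩
  rw [isTrajectory_iff hε] at H
  have hτ : 0 ≤ (t : ℝ) / ε := by positivity
  obtain ⟨hξ, hη⟩ := H _ hτ
  have hint := hl.le_integral hτ hα (hξ.continuousOn hτ) (hη.continuousOn hτ) (C := -C)
    fun s hs => hC _ (by
      rw [mem_closedBall_iff_norm]
      have h1 := norm_slow_sub_le hε.le hQ hξ x₀ hs
      have h2 : ε * Q * s ≤ ε * Q * (t / ε) := by gcongr; exact hs.2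
      have h3 : ε * Q * (t / ε) = Q * t := by field_simp
      have h4 : Q * t ≤ Q * (t₀ + 1) := by gcongr; linarith
      simp only at h1
      linarith) _ _
  rw [EReal.coe_le_coe_iff]
  simp only [cost]
  have h5 : ε * ((t / ε) * -C) ≤ ε * ∫ s in (0 : ℝ)..(t / ε), l (ξ s) (η s) (α s) := by gcongr
  have h6 : ε * ((t / ε) * -C) = -(t * C) := by field_simp
  have h7 : t * C ≤ (t₀ + 1) * C := by gcongr; linarith
  linarith [hc₀ (ξ (t / ε)) (η (t / ε))]

/-- Regulation towards `y₀` itself keeps the whole trajectory in a compact set independent of `ε`,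
where both costs are bounded; the arrival time plays no role. -/
lemma exists_upperSemilimit_le_coe (hfg : DynamicsAssumption f g) (hg : UniformDescent g)
    (hl : RunningCostAssumption l) (hu₀ : TerminalCostAssumption u₀)
    (x₀ : E N) (y₀ : E M) (t₀ : ℝ≥0) :
    ∃ c : ℝ, upperSemilimit (valueFunction f g l u₀) (x₀, y₀, t₀) ≤ c := by
  obtain ⟨Q, hQ0, hQ⟩ := hfg.exists_bound
  obtain ⟨_, _, hreg⟩ := exists_regulated hfg hg hQ x₀ (1 + Q * (t₀ + 1)) y₀ zero_le_one one_pos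
  have hK := (isCompact_closedBall x₀ (1 + Q * (t₀ + 1))).prod
    (isCompact_closedBall y₀ (1 + 3 * 1))
  obtain ⟨C, hC0, hC⟩ := hl.exists_bound hK
  obtain ⟨C', hC'⟩ := hK.exists_bound_of_continuousOn hu₀.1.continuousOn
  refine ⟨(t₀ + 1) * C + C', ?_⟩
  rw [upperSemilimit_eq_limsup]
  refine limsup_le_of_le (by isBoundedDefault) ?_
  filter_upwards [eventually_near x₀ y₀ t₀ one_pos] with ⟨ε, x, y, t⟩ ⟨hε, hε1, hx, hy, ht⟩
  simp only at hε hε1 hx hy ht ⊢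
  have ht' := abs_lt.1 ht
  obtain ⟨α, ξ, η, hα, hξ, hη, hb⟩ := hreg ε hε hε1.le x y hy.le
  refine (valueFunction_le_cost hα
    ((isTrajectory_iff hε).2 fun τ hτ => ⟨hξ τ hτ, hη τ hτ⟩)).trans ?_
  have hτ : 0 ≤ (t : ℝ) / ε := by positivity
  have hR : ∀ s ∈ Icc 0 ((t : ℝ) / ε), ‖x - x₀‖ + ε * Q * s ≤ 1 + Q * (t₀ + 1) := fun s hs => by
    have h2 : ε * Q * s ≤ ε * Q * (t / ε) := by gcongr; exact hs.2
    have h3 : ε * Q * (t / ε) = Q * t := by field_simp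
    have h4 : Q * t ≤ Q * (t₀ + 1) := by gcongr; linarith
    linarith
  have hmem : ∀ s ∈ Icc 0 ((t : ℝ) / ε), (ξ s, η s) ∈
      Metric.closedBall x₀ (1 + Q * (t₀ + 1)) ×ˢ Metric.closedBall y₀ (1 + 3 * 1) := fun s hs => by
    refine ⟨?_, ?_⟩
    · rw [mem_closedBall_iff_norm]
      exact (norm_slow_sub_le hε.le hQ (hξ _ hτ) x₀ hs).trans (hR s hs)
    · rw [mem_closedBall_iff_norm]
      exact (hb s hs.1 (hR s hs)).1
  have hint := hl.integral_le hτ hα ((hξ _ hτ).continuousOn hτ) ((hη _ hτ).continuousOn hτ)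
    fun s hs => (le_abs_self _).trans (hC _ (hmem s hs) _)
  rw [EReal.coe_le_coe_iff]
  simp only [cost]
  have h5 : ε * ∫ s in (0 : ℝ)..(t / ε), l (ξ s) (η s) (α s) ≤ ε * ((t / ε) * C) := by gcongr
  have h6 : ε * ((t / ε) * C) = t * C := by field_simp
  have h7 : t * C ≤ (t₀ + 1) * C := by gcongr; linarith
  have h8 := (le_abs_self _).trans (hC' _ (hmem _ ⟨hτ, le_rfl⟩))
  simp only at h8
  linarith

end Semilimits

end SingPert

theorem proposition2p8 (N M k : ℕ) (hN : 0 < N) (hM : 0 < M)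
    (A : Set (SingPert.E k)) (hA : IsCompact A)
    (f : SingPert.E N → SingPert.E M → A → SingPert.E N)
    (g : SingPert.E N → SingPert.E M → A → SingPert.E M)
    (l : SingPert.E N → SingPert.E M → A → ℝ)
    (u₀ : SingPert.E N → SingPert.E M → ℝ)
    (hfg : SingPert.DynamicsAssumption f g)
    (hg : SingPert.TotalControllability g)
    (hl : SingPert.RunningCostAssumption l)
    (hu₀ : SingPert.TerminalCostAssumption u₀) :
    (∀ (x₀ : SingPert.E N) (y₀ z₀ : SingPert.E M) (t₀ : ℝ≥0), 0 < t₀ →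
      SingPert.lowerSemilimit (SingPert.valueFunction f g l u₀) (x₀, y₀, t₀) =
        SingPert.lowerSemilimit (SingPert.valueFunction f g l u₀) (x₀, z₀, t₀) ∧
      SingPert.upperSemilimit (SingPert.valueFunction f g l u₀) (x₀, y₀, t₀) =
        SingPert.upperSemilimit (SingPert.valueFunction f g l u₀) (x₀, z₀, t₀)) ∧
    ∃ Vlow Vup : SingPert.E N → ℝ≥0 → ℝ,
      ∀ (x : SingPert.E N) (y : SingPert.E M) (t : ℝ≥0), 0 < t →
        SingPert.lowerSemilimit (SingPert.valueFunction f g l u₀) (x, y, t) =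
          ((Vlow x t : ℝ) : EReal) ∧
        SingPert.upperSemilimit (SingPert.valueFunction f g l u₀) (x, y, t) =
          ((Vup x t : ℝ) : EReal) := by
  have hdesc := hg.uniformDescent hfg hM
  have : CompactSpace A := isCompact_iff_compactSpace.1 hA
  have hlow : ∀ x₀ y₀ z₀ t₀,
      SingPert.lowerSemilimit (SingPert.valueFunction f g l u₀) (x₀, y₀, t₀) =
        SingPert.lowerSemilimit (SingPert.valueFunction f g l u₀) (x₀, z₀, t₀) :=
    fun x₀ y₀ z₀ t₀ => le_antisymm
      (SingPert.lowerSemilimit_valueFunction_le hfg hdesc hl x₀ z₀ y₀ t₀)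
      (SingPert.lowerSemilimit_valueFunction_le hfg hdesc hl x₀ y₀ z₀ t₀)
  have hup : ∀ x₀ y₀ z₀, ∀ t₀ : ℝ≥0, 0 < t₀ →
      SingPert.upperSemilimit (SingPert.valueFunction f g l u₀) (x₀, y₀, t₀) =
        SingPert.upperSemilimit (SingPert.valueFunction f g l u₀) (x₀, z₀, t₀) :=
    fun x₀ y₀ z₀ t₀ ht₀ => le_antisymm
      (SingPert.upperSemilimit_valueFunction_le hfg hdesc hl x₀ y₀ z₀ ht₀)
      (SingPert.upperSemilimit_valueFunction_le hfg hdesc hl x₀ z₀ y₀ ht₀)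
  refine ⟨fun x₀ y₀ z₀ t₀ ht₀ => ⟨hlow x₀ y₀ z₀ t₀, hup x₀ y₀ z₀ t₀ ht₀⟩,
    -- The base point `y = 0` is arbitrary, by independence of `y`.
    fun x t => (SingPert.lowerSemilimit (SingPert.valueFunction f g l u₀) (x, 0, t)).toReal,
    fun x t => (SingPert.upperSemilimit (SingPert.valueFunction f g l u₀) (x, 0, t)).toReal,
    fun x y t ht => ?_⟩
  obtain ⟨c, hc⟩ := SingPert.exists_coe_le_lowerSemilimit hfg hl hu₀ x 0 t
  obtain ⟨C, hC⟩ := SingPert.exists_upperSemilimit_le_coe hfg hdesc hl hu₀ x 0 t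
  have hle : SingPert.lowerSemilimit (SingPert.valueFunction f g l u₀) (x, 0, t) ≤
      SingPert.upperSemilimit (SingPert.valueFunction f g l u₀) (x, 0, t) :=
    SingPert.lowerSemilimit_le_upperSemilimit
  rw [hlow x y 0 t, hup x y 0 t ht, EReal.coe_toReal, EReal.coe_toReal]
  · exact ⟨rfl, rfl⟩
  · exact (hC.trans_lt (EReal.coe_lt_top C)).ne
  · exact ((EReal.bot_lt_coe c).trans_le (hc.trans hle)).ne'
  · exact ((hle.trans hC).trans_lt (EReal.coe_lt_top C)).ne
  · exact ((EReal.bot_lt_coe c).trans_le hc).ne'
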